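/- Let $L$ be a division ring (not necessarily commutative) and let $K\subset L$ be a commutative subfield that is central in $L$, i.e. $\lambda x = x\lambda$ for all $\lambda\in K$, $x\in L$. Let $A,B\subset L$ be $K$-subspaces of the same finite dimension $n$. A basis $\{a_1,\dots,a_n\}$ of $A$ is said to be matched to a basis $\{b_1,\dots,b_n\}$ of $B$ if, for all $i\in\{1,\dots,n\}$ and all $b\in B$, $$a_i b\in A \;\Longrightarrow\; b\in\langle b_1,\dots,\widehat{b_i},\dots,b_n\rangle,$$ where $\langle b_1,\dots,\widehat{b_i},\dots,b_n\rangle$ is the hyperplane of $B$ spanned over $K$ by the $b_j$ with $j\neq i$. The subspace $A$ is said to be matched to $B$ if every basis of $A$ is matched to some basis of $B$. Theorem. Let $B$ be a finite-dimensional $K$-subspace of $L$. Then $B$ is matched to itself if and only if $1\notin B$. -/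

import Mathlib

/-- Let `A`, `B` be `n`-dimensional `K`-subspaces of `L`. The basis `a₁, …, aₙ` of `A` is matched
to the basis `b₁, …, bₙ` of `B` if, for every `i` and every `x ∈ B`, `aᵢ x ∈ A` implies that `x`
lies in the hyperplane of `B` spanned by the `bⱼ` with `j ≠ i`. -/
def IsMatchedBasis {K L : Type*} [Field K] [DivisionRing L] [Algebra K L] {A B : Submodule K L}
    {n : ℕ} (a : Module.Basis (Fin n) K A) (b : Module.Basis (Fin n) K B) : Prop :=
  ∀ (i : Fin n) (x : B), (a i : L) * (x : L) ∈ A → x ∈ Submodule.span K (b '' {j | j ≠ i})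

/-- For finite-dimensional subspaces `A`, `B` of the same dimension: `A` is matched to `B` if every
basis of `A` is matched to some basis of `B`. -/
def IsMatchedSubspace {K L : Type*} [Field K] [DivisionRing L] [Algebra K L]
    (A B : Submodule K L) : Prop :=
  ∀ (n : ℕ) (a : Module.Basis (Fin n) K A), ∃ b : Module.Basis (Fin n) K B, IsMatchedBasis a b

/-!
If `1 ∈ B` and a basis `a` of `B` is matched to a basis `b`, then `aᵢ * 1 ∈ B` for all `i`, so `1`
lies in every hyperplane spanned by the `bⱼ` with `j ≠ i`; hence all its coordinates vanish, which is
absurd.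

Conversely, let `1 ∉ B`, let `a` be a basis of `B`, and put `Vᵢ = {x ∈ B | aᵢ x ∈ B}`. A basis `b`
fits exactly when its `i`-th coordinate functional vanishes on `Vᵢ`, so what is needed is a linearly
independent choice of functionals `fᵢ ∈ Vᵢ^⊥`. By the linear form of Rado's theorem
(`exists_linearIndependent_of_card_le_finrank_sup`) such a choice exists once
`#J ≤ dim ∑_{i ∈ J} Vᵢ^⊥`, that is, `#J + dim ⋂_{i ∈ J} Vᵢ ≤ dim B`, for every set `J` of indices.

With `A = ⟨aᵢ | i ∈ J⟩` and `U = ⋂_{i ∈ J} Vᵢ`, this inequality is a linear analogue of a theorem of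
Kemperman: if `A`, `U` and `AU` are contained in `B` and `1 ∉ B`, then `dim A + dim U ≤ dim B`
(`finrank_add_finrank_le_of_one_notMem`). It is clear when `A ∩ U = 0`. Otherwise, pick
`0 ≠ e ∈ A ∩ U` and replace `(A, U)` by `(A + Ae, {u ∈ U | eu ∈ U})` or by
`({a ∈ A | ae ∈ A}, U + eU)`. Both pairs satisfy the same hypotheses, the average of the two total
dimensions is `dim A + dim U`, and the pair really changes: `Ae = A` or `eU = U` would put `1`
into `B`.
-/

/-! ### Linearly independent transversals of a family of subspaces -/

/-- Linear form of Rado's theorem: a finite family of subspaces has a linearly independent system of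
representatives as soon as any `k` of its members span a space of dimension at least `k`. In a family
that is minimal with this property, every member is a line, by submodularity of the dimension. -/
theorem exists_linearIndependent_of_card_le_finrank_sup {K V ι : Type*} [Field K] [AddCommGroup V]
    [Module K V] [FiniteDimensional K V] [Fintype ι] (W : ι → Submodule K V)
    (hW : ∀ J : Finset ι, J.card ≤ Module.finrank K (J.sup W : Submodule K V)) :
    ∃ f : ι → V, (∀ i, f i ∈ W i) ∧ LinearIndependent K f := by
  classical
  induction W using WellFoundedLT.induction with
  | ind W ih =>
  have hne : ∀ i, ∃ x ∈ W i, x ≠ 0 := by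
    intro i
    by_contra! h
    have h0 : W i = ⊥ := (Submodule.eq_bot_iff _).2 h
    have := hW {i}
    simp [h0] at this
  choose f hf hf0 using hne
  by_cases hspan : ∀ i, W i ≤ Submodule.span K {f i}
  · refine ⟨f, hf, ?_⟩
    rw [linearIndependent_iff_card_le_finrank_span]
    refine (hW Finset.univ).trans (Submodule.finrank_mono (Finset.sup_le fun i _ => ?_))
    exact (hspan i).trans (Submodule.span_mono (by simp))
  · push Not at hspan
    obtain ⟨i, hi⟩ := hspan
    -- `W i` is the sum of two proper subspaces: the line `H` and a relative complement `H'`.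
    obtain ⟨C, hC⟩ := Submodule.exists_isCompl (Submodule.span K {f i})
    set H := Submodule.span K {f i} with hH
    have hHW : H ≤ W i := by simpa [hH] using hf i
    set H' := C ⊓ W i with hH'
    have hsum : H ⊔ H' = W i := by
      rw [hH', ← sup_inf_assoc_of_le _ hHW, hC.sup_eq_top, top_inf_eq]
    have hHlt : H < W i := lt_of_le_not_ge hHW hi
    have hH'lt : H' < W i := by
      refine lt_of_le_not_ge inf_le_right fun h => hf0 i ?_
      have h1 : f i ∈ C := (h (hf i)).1
      exact (Submodule.disjoint_def.1 hC.disjoint) _ (Submodule.mem_span_singleton_self _) h1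
    -- A family shrunk at `i` is handled by induction, unless some `J ∌ i` obstructs it.
    have key : ∀ G : Submodule K V, G < W i →
        (∃ f : ι → V, (∀ i, f i ∈ W i) ∧ LinearIndependent K f) ∨
        ∃ J : Finset ι, i ∉ J ∧ Module.finrank K (G ⊔ J.sup W : Submodule K V) ≤ J.card := by
      intro G hG
      have hlt : Function.update W i G < W := update_lt_self_iff.2 hG
      by_cases hc : ∀ J : Finset ι,
          J.card ≤ Module.finrank K (J.sup (Function.update W i G) : Submodule K V)
      · obtain ⟨g, hg, hgi⟩ := ih _ hlt hc
        exact Or.inl ⟨g, fun j => hlt.le j (hg j), hgi⟩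
      · push Not at hc
        obtain ⟨J, hJ⟩ := hc
        have hoff : ∀ S : Finset ι, i ∉ S → S.sup (Function.update W i G) = S.sup W := by
          intro S hS
          refine Finset.sup_congr rfl fun j hj => ?_
          rw [Function.update_of_ne (by rintro rfl; exact hS hj)]
        by_cases hiJ : i ∈ J
        · refine Or.inr ⟨J.erase i, Finset.notMem_erase i J, ?_⟩
          rw [← Finset.insert_erase hiJ, Finset.sup_insert, Function.update_self,
            hoff _ (Finset.notMem_erase i J),
            Finset.card_insert_of_notMem (Finset.notMem_erase i J)] at hJ
          omega
        · rw [hoff J hiJ] at hJ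
          exact absurd (hW J) (by omega)
    rcases key H hHlt with h | ⟨J, hiJ, hJ⟩
    · exact h
    rcases key H' hH'lt with h | ⟨J', hiJ', hJ'⟩
    · exact h
    exfalso
    have hmod := Submodule.finrank_sup_add_finrank_inf_eq (H ⊔ J.sup W) (H' ⊔ J'.sup W)
    have hsup : (insert i (J ∪ J')).sup W ≤ (H ⊔ J.sup W) ⊔ (H' ⊔ J'.sup W) := by
      rw [Finset.sup_insert, Finset.sup_union, ← hsum, sup_sup_sup_comm]
    have hinf : (J ∩ J').sup W ≤ (H ⊔ J.sup W) ⊓ (H' ⊔ J'.sup W) :=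
      le_inf ((Finset.sup_mono Finset.inter_subset_left).trans le_sup_right)
        ((Finset.sup_mono Finset.inter_subset_right).trans le_sup_right)
    have h1 := (hW _).trans (Submodule.finrank_mono hsup)
    have h2 := (hW _).trans (Submodule.finrank_mono hinf)
    rw [Finset.card_insert_of_notMem (by simp [hiJ, hiJ'])] at h1
    have h3 := Finset.card_union_add_card_inter J J'
    omega

/-! ### A dimension bound for products of subspaces avoiding `1` -/

/-- The two spaces derived from `A` and an injective endomorphism `f` have average dimension
`dim A`, because `f` maps `A ∩ f⁻¹(A)` isomorphically onto `A ∩ f(A)`. -/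
theorem Submodule.finrank_sup_map_add_finrank_inf_comap {K V : Type*} [Field K] [AddCommGroup V]
    [Module K V] (A : Submodule K V) [FiniteDimensional K A] (f : V →ₗ[K] V)
    (hf : Function.Injective f) :
    Module.finrank K (A ⊔ A.map f : Submodule K V) +
      Module.finrank K (A ⊓ A.comap f : Submodule K V) = 2 * Module.finrank K A := by
  have h1 := Submodule.finrank_sup_add_finrank_inf_eq A (A.map f)
  have h2 : (A ⊓ A.comap f).map f = A ⊓ A.map f := by
    rw [← Submodule.map_inf_eq_map_inf_comap, inf_comm]
  rw [← h2, ← (Submodule.equivMapOfInjective f hf _).finrank_eq,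
    ← (Submodule.equivMapOfInjective f hf A).finrank_eq] at h1
  omega

theorem Submodule.finrank_inf_comap_lt {K V : Type*} [Field K] [AddCommGroup V]
    [Module K V] (A : Submodule K V) [FiniteDimensional K A] (f : V →ₗ[K] V)
    (hf : Function.Injective f) (hA : A.map f ≠ A) :
    Module.finrank K (A ⊓ A.comap f : Submodule K V) < Module.finrank K A := by
  refine Submodule.finrank_lt_finrank_of_lt (lt_of_le_not_ge inf_le_left fun h => hA ?_)
  exact Submodule.eq_of_le_of_finrank_eq (Submodule.map_le_iff_le_comap.2 (h.trans inf_le_right))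
    (Submodule.equivMapOfInjective f hf A).finrank_eq.symm

/-- A linear analogue of Kemperman's theorem on products with a uniquely represented element, the
element here being `1` in `(K + A)(K + U)`. One of the two transformed pairs either increases
`dim A + dim U`, which is at most `2 dim B`, or keeps it and decreases `dim U`. -/
theorem finrank_add_finrank_le_of_one_notMem {K L : Type*} [Field K] [DivisionRing L] [Algebra K L]
    (B : Submodule K L) [FiniteDimensional K B] (h1 : (1 : L) ∉ B) (A U : Submodule K L)
    (hA : A ≤ B) (hU : U ≤ B) (hAU : ∀ a ∈ A, ∀ u ∈ U, a * u ∈ B) :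
    Module.finrank K A + Module.finrank K U ≤ Module.finrank K B := by
  have : FiniteDimensional K A := Submodule.finiteDimensional_of_le hA
  have : FiniteDimensional K U := Submodule.finiteDimensional_of_le hU
  by_cases hd : A ⊓ U = ⊥
  · have h := Submodule.finrank_sup_add_finrank_inf_eq A U
    rw [hd, finrank_bot, add_zero] at h
    rw [← h]
    exact Submodule.finrank_mono (sup_le hA hU)
  obtain ⟨e, he, he0⟩ := Submodule.exists_mem_ne_zero_of_ne_bot hd
  obtain ⟨heA, heU⟩ := he
  have hr : Function.Injective (LinearMap.mulRight K e) := mul_left_injective₀ he0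
  have hl : Function.Injective (LinearMap.mulLeft K e) := mul_right_injective₀ he0
  have hrA : A.map (LinearMap.mulRight K e) ≠ A := by
    intro h
    obtain ⟨x, hx, hxe⟩ := h.ge heA
    have : x = 1 := mul_right_cancel₀ he0 (by simpa using hxe)
    exact h1 (hA (this ▸ hx))
  have hlU : U.map (LinearMap.mulLeft K e) ≠ U := by
    intro h
    obtain ⟨x, hx, hxe⟩ := h.ge heU
    have : x = 1 := mul_left_cancel₀ he0 (by simpa using hxe)
    exact h1 (hU (this ▸ hx))
  have sA := A.finrank_sup_map_add_finrank_inf_comap _ hr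
  have sU := U.finrank_sup_map_add_finrank_inf_comap _ hl
  have lU := U.finrank_inf_comap_lt _ hl hlU
  have hA' : A ⊔ A.map (LinearMap.mulRight K e) ≤ B := by
    refine sup_le hA ?_
    rintro _ ⟨x, hx, rfl⟩
    exact hAU x hx e heU
  have hU' : U ⊔ U.map (LinearMap.mulLeft K e) ≤ B := by
    refine sup_le hU ?_
    rintro _ ⟨x, hx, rfl⟩
    exact hAU e heA x hx
  -- These bounds keep the truncated subtraction in the termination measure from collapsing.
  have bA := Submodule.finrank_mono hA
  have bU := Submodule.finrank_mono hU
  have bA' := Submodule.finrank_mono hA'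
  have bU' := Submodule.finrank_mono hU'
  by_cases hc : Module.finrank K A + Module.finrank K U ≤
      Module.finrank K (A ⊔ A.map (LinearMap.mulRight K e) : Submodule K L) +
      Module.finrank K (U ⊓ U.comap (LinearMap.mulLeft K e) : Submodule K L)
  · refine hc.trans (finrank_add_finrank_le_of_one_notMem B h1 _ _ hA'
      (inf_le_left.trans hU) ?_)
    intro x hx u hu
    obtain ⟨y, hy, _, ⟨z, hz, rfl⟩, rfl⟩ := Submodule.mem_sup.1 hx
    rw [LinearMap.mulRight_apply, add_mul, mul_assoc]
    exact add_mem (hAU y hy u hu.1) (hAU z hz _ hu.2)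
  · have hc' : Module.finrank K A + Module.finrank K U <
        Module.finrank K (A ⊓ A.comap (LinearMap.mulRight K e) : Submodule K L) +
        Module.finrank K (U ⊔ U.map (LinearMap.mulLeft K e) : Submodule K L) := by omega
    refine hc'.le.trans (finrank_add_finrank_le_of_one_notMem B h1 _ _ (inf_le_left.trans hA)
      hU' ?_)
    intro x hx u hu
    obtain ⟨y, hy, _, ⟨z, hz, rfl⟩, rfl⟩ := Submodule.mem_sup.1 hu
    rw [LinearMap.mulLeft_apply, mul_add, ← mul_assoc]
    exact add_mem (hAU x hx.1 y hy) (hAU _ hx.2 z hz)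
termination_by (2 * Module.finrank K B - (Module.finrank K A + Module.finrank K U),
  Module.finrank K U)
decreasing_by
  · rw [Prod.lex_def]
    dsimp only
    omega
  · rw [Prod.lex_def]
    dsimp only
    omega

/-! ### Matched bases -/

/-- The subspace `{x ∈ B | c x ∈ B}` of `B`. -/
def Submodule.leftTransporter {K L : Type*} [Field K] [DivisionRing L] [Algebra K L]
    (B : Submodule K L) (c : L) : Submodule K B :=
  B.comap ((LinearMap.mulLeft K c).comp B.subtype)

/-- Rado's condition for the annihilators of the spaces `{x ∈ B | aᵢ x ∈ B}`. -/
theorem card_le_finrank_sup_dualAnnihilator {K L : Type*} [Field K] [DivisionRing L] [Algebra K L]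
    (B : Submodule K L) [FiniteDimensional K B] (h1 : (1 : L) ∉ B) {ι : Type*}
    (a : Module.Basis ι K B) (J : Finset ι) :
    J.card ≤ Module.finrank K
      (J.sup fun i => (B.leftTransporter (a i)).dualAnnihilator : Submodule K (Module.Dual K B)) := by
  set Φ : Subspace K (Module.Dual K B) :=
    J.sup fun i => (B.leftTransporter (a i)).dualAnnihilator with hΦ
  have hdim := Subspace.finrank_add_finrank_dualCoannihilator_eq Φ
  have hmem : ∀ x ∈ Φ.dualCoannihilator, ∀ i ∈ J, (a i : L) * (x : L) ∈ B := by
    intro x hx i hi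
    have hle : (B.leftTransporter (a i)).dualAnnihilator ≤ Φ :=
      Finset.le_sup (f := fun i => (B.leftTransporter (a i)).dualAnnihilator) hi
    have := Submodule.dualCoannihilator_anti hle hx
    rw [Subspace.dualAnnihilator_dualCoannihilator_eq] at this
    exact this
  have hli : LinearIndependent K fun i : J => (a i : L) :=
    (a.linearIndependent.map' B.subtype B.ker_subtype).comp _ Subtype.val_injective
  have hA := finrank_span_eq_card hli
  have key := finrank_add_finrank_le_of_one_notMem B h1
    (Submodule.span K (Set.range fun i : J => (a i : L))) (Φ.dualCoannihilator.map B.subtype)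
    (Submodule.span_le.2 (by rintro _ ⟨i, rfl⟩; exact (a i).2)) (Submodule.map_subtype_le _ _) ?_
  · rw [hA, Fintype.card_coe, Submodule.finrank_map_subtype_eq] at key
    omega
  · rintro y hy _ ⟨x, hx, rfl⟩
    refine (Submodule.span_le (p := B.comap (LinearMap.mulRight K (x : L)))).2 ?_ hy
    rintro _ ⟨i, rfl⟩
    exact hmem x hx i i.2

theorem mainTheorem2 {K L : Type*} [Field K] [DivisionRing L] [Algebra K L]
    (B : Submodule K L) [FiniteDimensional K B] :
    IsMatchedSubspace B B ↔ (1 : L) ∉ B := by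
  constructor
  · intro h hone
    obtain ⟨b, hb⟩ := h _ (Module.finBasis K B)
    have hzero : (⟨1, hone⟩ : B) = 0 := by
      refine b.ext_elem fun i => ?_
      have hi := hb i ⟨1, hone⟩ (by simp)
      rw [b.mem_span_image] at hi
      rw [map_zero, Finsupp.zero_apply, ← Finsupp.notMem_support_iff]
      exact fun hs => hi hs rfl
    exact one_ne_zero (congrArg Subtype.val hzero)
  · intro h1 n a
    obtain ⟨f, hf, hfi⟩ := exists_linearIndependent_of_card_le_finrank_sup
      (fun i => (B.leftTransporter (a i)).dualAnnihilator)
      (card_le_finrank_sup_dualAnnihilator B h1 a)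
    let c : Module.Basis (Fin n) K (Module.Dual K B) :=
      basisOfLinearIndependentOfCardEqFinrank' f hfi
        (by rw [Subspace.dual_finrank_eq, Module.finrank_eq_card_basis a])
    -- The basis of `B` whose coordinate functionals are the `f i`.
    let b : Module.Basis (Fin n) K B := c.dualBasis.map (Module.evalEquiv K B).symm
    have hrepr : ∀ (x : B) (i : Fin n), b.repr x i = f i x := by
      intro x i
      simp [b, c]
    refine ⟨b, fun i x hx => ?_⟩
    rw [b.mem_span_image]
    rintro j hj rfl
    rw [Finset.mem_coe, Finsupp.mem_support_iff, hrepr] at hj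
    exact hj ((Submodule.mem_dualAnnihilator _).1 (hf j) x hx)
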